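/- Let $D$ be a diagram of an oriented spatial graph $G$ in $\mathbb{S}^3$ whose edges $e_1,\dots,e_r$ are labelled by natural numbers $N=(n_1,\dots,n_r)$. The *fundamental $N$-quandle* $Q_N(G)$ is the quandle with one generator for each arc of $D$ and the following relations: $x_i=x_k\rhd x_j$ at each crossing, where $x_j$ is the over-arc and $x_k$ and $x_i$ are the under-arcs to the left and to the right of $x_j$; $(\cdots((x\rhd^{\varepsilon_1}a_1)\rhd^{\varepsilon_2}a_2)\cdots)\rhd^{\varepsilon_s}a_s=x$ for every element $x$ at each vertex, where $a_1,\dots,a_s$ are the incident arcs in counterclockwise order, $\varepsilon_i=1$ if $a_i$ is directed into the vertex and $\varepsilon_i=-1$ if it is directed out of it; and $(\cdots(x\rhd y)\rhd\cdots)\rhd y=x$, with $y$ repeated $n_i$ times, for every element $x$ and every arc $y$ of the edge $e_i$. For an integer $k\neq 0$ let $G(k,m)$ be the following labelled spatial graph. Take two parallel strands that run around an annulus and pass through a block of $k$ right-handed half-twists (of $|k|$ left-handed half-twists if $k<0$), and join the two strands, outside the block, by a single strut. The strut is labelled by an integer $m\ge 1$, and each of the other two edges is labelled $2$. Then $G(k,m)$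 is a theta graph if $k$ is odd and a handcuff graph if $k$ is even. For every orientation of its edges, and with the labelling $N=(2,2,m)$ (the strut being the third edge), the $N$-quandle of $G(k,m)$ has exactly $2|k|m+2|k|$ elements; for $k>0$ this is $$|Q_N(G(k,m))| = 2km+2k .$$ -/

import Mathlib

/-! ### Quandles presented by generators and relations

The operations are written on the right, as in `x ▷ y` and `x ▷⁻¹ y` (`y` acts on `x`).
Mathlib's `Quandle` writes the acting element on the left, so `x ▷ y` is Mathlib's `y ◃ x`. -/

/-- Formal quandle expressions in generators from `S`. -/
inductive QuandleTerm (S : Type) : Type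
  /-- a generator -/
  | gen (s : S) : QuandleTerm S
  /-- `act x y` is `x ▷ y` -/
  | act (x y : QuandleTerm S) : QuandleTerm S
  /-- `invAct x y` is `x ▷⁻¹ y` -/
  | invAct (x y : QuandleTerm S) : QuandleTerm S

namespace QuandleTerm

/-- The smallest congruence on expressions that contains the relations `r` and the quandle
axioms. -/
inductive Congr {S : Type} (r : QuandleTerm S → QuandleTerm S → Prop) :
    QuandleTerm S → QuandleTerm S → Prop
  | of {x y} : r x y → Congr r x y
  | refl (x) : Congr r x x
  | symm {x y} : Congr r x y → Congr r y x
  | trans {x y z} : Congr r x y → Congr r y z → Congr r x z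
  | act {x x' y y'} : Congr r x x' → Congr r y y' → Congr r (.act x y) (.act x' y')
  | invAct {x x' y y'} : 
      Congr r x x' → Congr r y y' → Congr r (.invAct x y) (.invAct x' y')
  | idem (x) : Congr r (.act x x) x
  | act_invAct (x y) : Congr r (.invAct (.act x y) y) x
  | invAct_act (x y) : Congr r (.act (.invAct x y) y) x
  | distrib (x y z) : 
      Congr r (.act (.act x y) z) (.act (.act x z) (.act y z))

end QuandleTerm

/-- The quandle `⟨S | r⟩` presented by the generators `S` and the relations `r`. -/
def PresentedQuandle {S : Type} (r : QuandleTerm S → QuandleTerm S → Prop) : Type :=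
  Quot (QuandleTerm.Congr r)

instance PresentedQuandle.instQuandle {S : Type} (r : QuandleTerm S → QuandleTerm S → Prop) :
    Quandle (PresentedQuandle r) where
  act y x := Quot.map₂ (r := QuandleTerm.Congr r) (s := QuandleTerm.Congr r)
    (t := QuandleTerm.Congr r) QuandleTerm.act (fun x _ _ h => .act (.refl x) h)
    (fun _ _ y h => .act h (.refl y)) x y
  invAct y x := Quot.map₂ (r := QuandleTerm.Congr r) (s := QuandleTerm.Congr r)
    (t := QuandleTerm.Congr r) QuandleTerm.invAct (fun x _ _ h => .invAct (.refl x) h)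
    (fun _ _ y h => .invAct h (.refl y)) x y
  self_distrib := by
    rintro ⟨z⟩ ⟨y⟩ ⟨x⟩
    exact Quot.sound (.distrib x y z)
  left_inv := by
    rintro ⟨y⟩ ⟨x⟩
    exact Quot.sound (.act_invAct x y)
  right_inv := by
    rintro ⟨y⟩ ⟨x⟩
    exact Quot.sound (.invAct_act x y)
  fix := by
    rintro ⟨x⟩
    exact Quot.sound (.idem x)

/-! ### Diagrams of spatial graphs -/

/-- A planar diagram code.  Crossings and vertices (the nodes) cut a diagram into semi-arcs, called
strands; `(s, false)` and `(s, true)` are the two ends of the strand `s`.  Around a crossing the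
four ends are listed counterclockwise, positions `0` and `2` belonging to the lower strands and
positions `1` and `3` to the upper strands.  Around a vertex the ends are also listed
counterclockwise. -/
structure PlanarDiagramCode where
  Strand : Type
  Crossing : Type
  Vertex : Type
  crossingEnd : Crossing → Fin 4 → Strand × Bool
  degree : Vertex → ℕ
  vertexEnd : (v : Vertex) → Fin (degree v) → Strand × Bool

namespace PlanarDiagramCode

variable (P : PlanarDiagramCode)

/-- The positions around the nodes at which the ends of strands are attached. -/
abbrev Position : Type := (P.Crossing × Fin 4) ⊕ ((v : P.Vertex) × Fin (P.degree v))

/-- The end that is attached at a position. -/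
def endAt : P.Position → P.Strand × Bool
  | .inl (c, i) => P.crossingEnd c i
  | .inr ⟨v, i⟩ => P.vertexEnd v i

/-- The node to which a position belongs. -/
def node : P.Position → P.Crossing ⊕ P.Vertex
  | .inl (c, _) => .inl c
  | .inr ⟨v, _⟩ => .inr v

/-- The next position around the same node, counterclockwise. -/
def next : P.Position → P.Position
  | .inl (c, i) => .inl (c, finRotate 4 i)
  | .inr ⟨v, i⟩ => .inr ⟨v, finRotate (P.degree v) i⟩

/-- The other end of the strand attached at `p` is attached at `q`. -/
def Linked (p q : P.Position) : Prop :=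
  P.endAt q = ((P.endAt p).1, !(P.endAt p).2)

/-- The faces: orbits of sectors between consecutive positions around a node, where a sector is
named by the first of the two positions, under going from a sector along the boundary of its face
to the following one. -/
def Face : Type := Quot fun p q : P.Position => P.Linked (P.next p) q

/-- The connected components of the diagram, as an abstract graph on its nodes. -/
def Component : Type :=
  Quot fun u v : P.Crossing ⊕ P.Vertex => ∃ p q, P.Linked p q ∧ P.node p = u ∧ P.node q = v

/-- The strand `t` continues the strand `s` straight through a crossing. -/
def Continues (s t : P.Strand) : Prop :=
  ∃ c, (s = (P.crossingEnd c 0).1 ∧ t = (P.crossingEnd c 2).1) ∨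
    (s = (P.crossingEnd c 1).1 ∧ t = (P.crossingEnd c 3).1)

end PlanarDiagramCode

/-- A regular diagram, on the oriented sphere, of a spatial graph in `S³`. -/
structure SpatialGraphDiagram extends PlanarDiagramCode where
  finite_strand : Finite Strand
  finite_crossing : Finite Crossing
  finite_vertex : Finite Vertex
  /-- every end of every strand is attached at exactly one position -/
  bijective_endAt : Function.Bijective toPlanarDiagramCode.endAt
  /-- the diagram lies on a sphere: Euler's formula -/
  planar : Nat.card Crossing + Nat.card Vertex + Nat.card toPlanarDiagramCode.Face =
    Nat.card Strand + 2 * Nat.card toPlanarDiagramCode.Component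
  /-- the edges of the graph (a closed curve without vertices also counts as an edge) -/
  Edge : Type
  /-- the edge on which a strand lies -/
  edge : Strand → Edge
  edge_surjective : Function.Surjective edge
  /-- two strands lie on the same edge iff one gets from one to the other by passing straight
  through crossings -/
  edge_eq_iff : ∀ s t, edge s = edge t ↔ Relation.EqvGen toPlanarDiagramCode.Continues s t

namespace SpatialGraphDiagram

variable (D : SpatialGraphDiagram)

/-- The number of ends of the edge `e` at the vertex `v`. -/
noncomputable def edgeEnds (v : D.Vertex) (e : D.Edge) : ℕ :=
  Nat.card {i : Fin (D.degree v) // D.edge (D.vertexEnd v i).1 = e}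

/-- The underlying graph is a theta graph: two vertices joined by three edges. -/
def IsTheta : Prop :=
  ∃ u v : D.Vertex, u ≠ v ∧ (∀ w, w = u ∨ w = v) ∧
    ∃ p q r : D.Edge, p ≠ q ∧ p ≠ r ∧ q ≠ r ∧ (∀ e, e = p ∨ e = q ∨ e = r) ∧
      ∀ e, D.edgeEnds u e = 1 ∧ D.edgeEnds v e = 1

/-- The underlying graph is a handcuff graph: two vertices with a loop at each of them, and an
edge that joins them. -/
def IsHandcuff : Prop :=
  ∃ u v : D.Vertex, u ≠ v ∧ (∀ w, w = u ∨ w = v) ∧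
    ∃ p q r : D.Edge, p ≠ q ∧ p ≠ r ∧ q ≠ r ∧ (∀ e, e = p ∨ e = q ∨ e = r) ∧
      (D.edgeEnds u p = 2 ∧ D.edgeEnds v p = 0) ∧
      (D.edgeEnds u q = 0 ∧ D.edgeEnds v q = 2) ∧
      (D.edgeEnds u r = 1 ∧ D.edgeEnds v r = 1)

/-- An orientation of (all edges of) the graph: the strand `s` runs towards its end
`(s, head s)`, and directions agree when one passes straight through a crossing. -/
structure Orientation where
  head : D.Strand → Bool
  coherent : ∀ c i, (head (D.crossingEnd c i).1 = (D.crossingEnd c i).2) ↔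
    ¬ (head (D.crossingEnd c (i + 2)).1 = (D.crossingEnd c (i + 2)).2)

variable {D}

/-- The strand of the end `e` is directed into the node at that end. -/
def Orientation.Incoming (o : D.Orientation) (e : D.Strand × Bool) : Prop :=
  o.head e.1 = e.2

instance (o : D.Orientation) (e : D.Strand × Bool) : Decidable (o.Incoming e) :=
  inferInstanceAs (Decidable (o.head e.1 = e.2))

open QuandleTerm in
/-- The Wirtinger relations of an oriented diagram.  The two strands of an overpass are the same
arc.  At a crossing, (arc on the right) = (arc on the left) `▷` (over-arc), where right and left are
those of the directed over-arc.  At a vertex, acting on any `x` successively by the incident arcs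
in counterclockwise order, by `▷` for an arc directed into the vertex and by `▷⁻¹` for an arc
directed out of it, gives back `x`. -/
inductive WirtingerRel (o : D.Orientation) :
    QuandleTerm D.Strand → QuandleTerm D.Strand → Prop
  | over (c : D.Crossing) :
      WirtingerRel o (gen (D.crossingEnd c 1).1) (gen (D.crossingEnd c 3).1)
  | crossing_from_three (c : D.Crossing) : o.Incoming (D.crossingEnd c 3) →
      WirtingerRel o (gen (D.crossingEnd c 0).1)
        ((gen (D.crossingEnd c 2).1).act (gen (D.crossingEnd c 1).1))
  | crossing_from_one (c : D.Crossing) : o.Incoming (D.crossingEnd c 1) →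
      WirtingerRel o (gen (D.crossingEnd c 2).1)
        ((gen (D.crossingEnd c 0).1).act (gen (D.crossingEnd c 1).1))
  | vertex (v : D.Vertex) (x : QuandleTerm D.Strand) :
      WirtingerRel o
        ((List.ofFn (D.vertexEnd v)).foldl
          (fun z e => if o.Incoming e then z.act (gen e.1) else z.invAct (gen e.1)) x) x

/-- The fundamental quandle of an oriented spatial graph, from a diagram of it. -/
def FundamentalQuandle (o : D.Orientation) : Type := PresentedQuandle (WirtingerRel o)

/-- The relations of the fundamental `N`-quandle: the Wirtinger relations, and
`x ▷ y ▷ ⋯ ▷ y = x` with `y` repeated `N e` times, for each `x` and each arc `y` of the edge `e`. -/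
inductive NRel (o : D.Orientation) (N : D.Edge → ℕ) :
    QuandleTerm D.Strand → QuandleTerm D.Strand → Prop
  | wirtinger {x y} : WirtingerRel o x y → NRel o N x y
  | power (x : QuandleTerm D.Strand) (y : D.Strand) :
      NRel o N ((fun z => z.act (.gen y))^[N (D.edge y)] x) x

/-- The fundamental `N`-quandle of an oriented spatial graph whose edges are labelled by `N`. -/
def FundamentalNQuandle (o : D.Orientation) (N : D.Edge → ℕ) : Type :=
  PresentedQuandle (NRel o N)

instance (o : D.Orientation) : Quandle (FundamentalQuandle o) := PresentedQuandle.instQuandle _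

instance (o : D.Orientation) (N : D.Edge → ℕ) : Quandle (FundamentalNQuandle o N) :=
  PresentedQuandle.instQuandle _

end SpatialGraphDiagram

/-! ### The graphs `G(k, m)`

Two parallel strands run around an annulus, through a block of `k` right-handed half-twists
(`|k|` left-handed ones if `k < 0`), and a strut joins them outside the block.  Draw the block and
the strut, which is below the block, with the strands running upwards.  `Sum.inl (i, false)` and `Sum.inl (i, true)` are the
left and the right strand between the crossings `i - 1` and `i`, counted from below.  Those with
`i = 0` start at the two vertices, run up, and enter the block from below; those with `i = |k|`
leave the block at the top, run around the annulus and reach the two vertices from below.  Vertex `false` is on the left, vertex `true` on the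
right.  The end `(s, false)` is the one where `s` starts.  `Sum.inr ()` is the strut, which starts
on the left. -/

namespace TwistStrut

/-- Strands of the diagram with `n` crossings. -/
abbrev Strand (n : ℕ) : Type := (Fin (n + 1) × Bool) ⊕ Unit

/-- The four ends around the crossing `i`, counterclockwise from a lower strand.  In a right-handed
half-twist the upper strand goes from bottom left to top right. -/
def crossingEnd (n : ℕ) (right : Bool) (i : Fin n) : Fin 4 → Strand n × Bool :=
  let bottomLeft := (Sum.inl (i.castSucc, false), true)
  let bottomRight := (Sum.inl (i.castSucc, true), true)
  let topRight := (Sum.inl (i.succ, true), false)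
  let topLeft := (Sum.inl (i.succ, false), false)
  if right then ![bottomRight, topRight, topLeft, bottomLeft]
  else ![bottomLeft, bottomRight, topRight, topLeft]

/-- The three ends around a vertex, counterclockwise from the top. -/
def vertexEnd (n : ℕ) : Bool → Fin 3 → Strand n × Bool
  | false => ![(.inl (0, false), false), (.inl (Fin.last n, false), true), (.inr (), false)]
  | true => ![(.inl (0, true), false), (.inr (), true), (.inl (Fin.last n, true), true)]

/-- Edge `0` is the one that starts on the left, edge `1` the one that starts on the right, and
edge `2` is the strut.  The first two change sides at each crossing. -/
def edge (n : ℕ) : Strand n → Fin 3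
  | .inl (i, side) => if side = i.val.bodd then 0 else 1
  | .inr () => 2

/-- The planar diagram code of the diagram with `n` crossings. -/
abbrev code (n : ℕ) (right : Bool) : PlanarDiagramCode where
  Strand := Strand n
  Crossing := Fin n
  Vertex := Bool
  crossingEnd := crossingEnd n right
  degree _ := 3
  vertexEnd := vertexEnd n

theorem bijective_endAt (n : ℕ) (right : Bool) : Function.Bijective (code n right).endAt := by
  let _ : Fintype (code n right).Position :=
    inferInstanceAs (Fintype (Fin n × Fin 4 ⊕ ((_ : Bool) × Fin 3)))
  let _ : Fintype ((code n right).Strand × Bool) := inferInstanceAs (Fintype (Strand n × Bool))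
  rw [Fintype.bijective_iff_surjective_and_card]
  refine ⟨?_, ?_⟩
  · rintro ⟨⟨i, s⟩ | u, b⟩
    · cases b
      · induction i using Fin.cases with
        | zero => exact ⟨.inr ⟨s, (0 : Fin 3)⟩, by cases s <;> rfl⟩
        | succ j =>
          cases right <;> cases s
          · exact ⟨.inl (j, 3), rfl⟩
          · exact ⟨.inl (j, 2), rfl⟩
          · exact ⟨.inl (j, 2), rfl⟩
          · exact ⟨.inl (j, 1), rfl⟩
      · induction i using Fin.lastCases with
        | last =>
          cases s
          · exact ⟨.inr ⟨false, (1 : Fin 3)⟩, rfl⟩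
          · exact ⟨.inr ⟨true, (2 : Fin 3)⟩, rfl⟩
        | cast j =>
          cases right <;> cases s
          · exact ⟨.inl (j, 0), rfl⟩
          · exact ⟨.inl (j, 1), rfl⟩
          · exact ⟨.inl (j, 3), rfl⟩
          · exact ⟨.inl (j, 0), rfl⟩
    · cases b
      · exact ⟨.inr ⟨false, (2 : Fin 3)⟩, rfl⟩
      · exact ⟨.inr ⟨true, (1 : Fin 3)⟩, rfl⟩
  · have h1 : Fintype.card (code n right).Position = n * 4 + 2 * 3 := by
      change Fintype.card (Fin n × Fin 4 ⊕ ((_ : Bool) × Fin 3)) = _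
      simp
    have h2 : Fintype.card ((code n right).Strand × Bool) = ((n + 1) * 2 + 1) * 2 := by
      change Fintype.card (Strand n × Bool) = _
      simp
    rw [h1, h2]
    ring

/-- The name of the face just counterclockwise of an end: `inr false` and `inr true` for the faces
on the left and on the right, `inl i` for the one between the crossings `i - 1` and `i`. -/
def faceName (n : ℕ) : Strand n × Bool → Fin (n + 1) ⊕ Bool
  | (.inl (_, false), false) => .inr false
  | (.inl (i, true), false) => .inl i
  | (.inl (i, false), true) => .inl i
  | (.inl (_, true), true) => .inr true
  | (.inr (), false) => .inl 0
  | (.inr (), true) => .inl (Fin.last n)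

theorem card_face (n : ℕ) (right : Bool) : Nat.card (code n right).Face = n + 3 := by
  have hb := bijective_endAt n right
  let pos : Strand n × Bool → (code n right).Position := (Equiv.ofBijective _ hb).symm
  have hpos : ∀ e, (code n right).endAt (pos e) = e :=
    fun e => (Equiv.ofBijective _ hb).apply_symm_apply e
  have hpos' : ∀ p, pos ((code n right).endAt p) = p :=
    fun p => (Equiv.ofBijective _ hb).symm_apply_apply p
  let cls : Strand n × Bool → (code n right).Face := fun e => Quot.mk _ (pos e)
  have key : ∀ p, cls ((code n right).endAt p) =
      cls (((code n right).endAt ((code n right).next p)).1,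
        !((code n right).endAt ((code n right).next p)).2) := by
    intro p
    refine Quot.sound ?_
    rw [hpos']
    exact hpos _
  have hW : ∀ c : Fin n, cls (.inl (c.succ, false), false) =
      cls (.inl (c.castSucc, false), false) := by
    intro c; cases right
    · exact key (.inl (c, 3))
    · exact key (.inl (c, 2))
  have hE : ∀ c : Fin n, cls (.inl (c.succ, true), true) =
      cls (.inl (c.castSucc, true), true) := by
    intro c; cases right
    · exact (key (.inl (c, 1))).symm
    · exact (key (.inl (c, 0))).symm
  have hN : ∀ c : Fin n, cls (.inl (c.succ, true), false) =
      cls (.inl (c.succ, false), true) := by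
    intro c; cases right
    · exact key (.inl (c, 2))
    · exact key (.inl (c, 1))
  have hT : cls (.inr (), false) = cls (.inl (0, false), true) :=
    key (.inr ⟨false, (2 : Fin 3)⟩)
  have hT' : cls (.inl (0, true), false) = cls (.inr (), false) :=
    key (.inr ⟨true, (0 : Fin 3)⟩)
  have hB : cls (.inr (), true) = cls (.inl (Fin.last n, true), false) :=
    key (.inr ⟨true, (1 : Fin 3)⟩)
  have hM : ∀ i, cls (.inl (i, true), false) = cls (.inl (i, false), true) := by
    intro i
    induction i using Fin.cases with
    | zero => exact hT'.trans hT
    | succ c => exact hN c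
  have hL : ∀ i, cls (.inl (i, false), false) = cls (.inl (0, false), false) := by
    intro i
    induction i using Fin.induction with
    | zero => rfl
    | succ c ih => exact (hW c).trans ih
  have hR : ∀ i, cls (.inl (i, true), true) = cls (.inl (0, true), true) := by
    intro i
    induction i using Fin.induction with
    | zero => rfl
    | succ c ih => exact (hE c).trans ih
  have hsound : ∀ p q : (code n right).Position,
      (code n right).Linked ((code n right).next p) q →
      faceName n ((code n right).endAt p) = faceName n ((code n right).endAt q) := by
    intro p q h
    rw [PlanarDiagramCode.Linked] at h
    rw [h]
    rcases p with ⟨c, i⟩ | ⟨v, i⟩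
    · change Fin 4 at i
      cases right <;> fin_cases i <;> rfl
    · change Fin 3 at i
      cases v <;> fin_cases i <;> rfl
  let e : (code n right).Face ≃ Fin (n + 1) ⊕ Bool :=
    { toFun := Quot.lift (fun p => faceName n ((code n right).endAt p)) hsound
      invFun := Sum.elim (fun i => cls (.inl (i, true), false))
        (fun b => cls (.inl (0, b), b))
      left_inv := by
        rintro ⟨p⟩
        rw [← hpos' p]
        generalize (code n right).endAt p = e
        change Sum.elim _ _ (faceName n ((code n right).endAt (pos e))) = cls e
        have h : faceName n ((code n right).endAt (pos e)) = faceName n e := congrArg _ (hpos e)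
        rw [h]
        rcases e with ⟨⟨i, _ | _⟩ | u, _ | _⟩
        · exact (hL i).symm
        · exact hM i
        · rfl
        · exact (hR i).symm
        · exact hT'
        · exact hB.symm
      right_inv := by
        rintro (i | b)
        · change faceName n ((code n right).endAt (pos _)) = _
          rw [hpos]
          rfl
        · change faceName n ((code n right).endAt (pos _)) = _
          rw [hpos]
          cases b <;> rfl }
  rw [Nat.card_congr e]
  simp

theorem card_component (n : ℕ) (right : Bool) : Nat.card (code n right).Component = 1 := by
  let cls : Fin n ⊕ Bool → (code n right).Component := fun u => Quot.mk _ u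
  have key : ∀ p q, (code n right).Linked p q →
      cls ((code n right).node p) = cls ((code n right).node q) :=
    fun p q h => Quot.sound ⟨p, q, h, rfl, rfl⟩
  have h0 : cls (.inr true) = cls (.inr false) :=
    key (.inr ⟨true, (1 : Fin 3)⟩) (.inr ⟨false, (2 : Fin 3)⟩) rfl
  have h1 : ∀ c : Fin n, cls (.inl c) = cls (.inr false) := by
    intro c
    cases n with
    | zero => exact c.elim0
    | succ n =>
      induction c using Fin.induction with
      | zero =>
        cases right
        · exact key (.inl ((0 : Fin (n + 1)), 0)) (.inr ⟨false, (0 : Fin 3)⟩) rfl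
        · exact key (.inl ((0 : Fin (n + 1)), 3)) (.inr ⟨false, (0 : Fin 3)⟩) rfl
      | succ c ih =>
        refine Eq.trans ?_ ih
        cases right
        · exact key (.inl (c.succ, 0)) (.inl (c.castSucc, 3)) rfl
        · exact key (.inl (c.succ, 3)) (.inl (c.castSucc, 2)) rfl
  rw [Nat.card_eq_one_iff_exists]
  refine ⟨cls (.inr false), ?_⟩
  rintro ⟨c | _ | _⟩
  · exact h1 c
  · rfl
  · exact h0

theorem edge_eq_iff (n : ℕ) (right : Bool) (s t : Strand n) :
    edge n s = edge n t ↔ Relation.EqvGen (code n right).Continues s t := by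
  have step : ∀ (c : Fin n) (b : Bool),
      Relation.EqvGen (code n right).Continues (.inl (c.succ, !b)) (.inl (c.castSucc, b)) := by
    intro c b
    cases right <;> cases b
    · exact .symm _ _ (.rel _ _ ⟨c, .inl ⟨rfl, rfl⟩⟩)
    · exact .symm _ _ (.rel _ _ ⟨c, .inr ⟨rfl, rfl⟩⟩)
    · exact .rel _ _ ⟨c, .inr ⟨rfl, rfl⟩⟩
    · exact .symm _ _ (.rel _ _ ⟨c, .inl ⟨rfl, rfl⟩⟩)
  have rep : ∀ (i : Fin (n + 1)) (b : Bool), Relation.EqvGen (code n right).Continues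
      (.inl (i, b)) (.inl (0, xor b i.val.bodd)) := by
    intro i
    induction i using Fin.induction with
    | zero => intro b; cases b <;> simpa using .refl _
    | succ c ih =>
      intro b
      have h := (step c (!b)).trans _ _ _ (ih (!b))
      simpa using h
  constructor
  · intro h
    rcases s with ⟨i, b⟩ | u <;> rcases t with ⟨j, d⟩ | w
    · have e : xor b i.val.bodd = xor d j.val.bodd := by
        revert h
        simp only [edge]
        cases b <;> cases d <;> cases i.val.bodd <;> cases j.val.bodd <;> simp
      have h2 := rep j d
      rw [← e] at h2
      exact (rep i b).trans _ _ _ (h2.symm _ _)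
    · revert h
      simp only [edge]
      split_ifs <;> intro h <;> exact absurd h (by decide)
    · revert h
      simp only [edge]
      split_ifs <;> intro h <;> exact absurd h (by decide)
    · exact .refl _
  · intro h
    induction h with
    | rel s t h =>
      obtain ⟨c, ⟨rfl, rfl⟩ | ⟨rfl, rfl⟩⟩ := h
      all_goals
        change Fin n at c
        cases right <;> simp [crossingEnd, edge]
    | refl => rfl
    | symm _ _ _ ih => exact ih.symm
    | trans _ _ _ _ _ ih1 ih2 => exact ih1.trans ih2

end TwistStrut

/-- The spatial graph `G(k, m)`, by its diagram (`m` is the label of the strut, edge `2`). -/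
def twistStrutGraph (k : ℤ) : SpatialGraphDiagram where
  toPlanarDiagramCode := TwistStrut.code k.natAbs (decide (0 < k))
  finite_strand := inferInstanceAs (Finite (TwistStrut.Strand k.natAbs))
  finite_crossing := inferInstanceAs (Finite (Fin k.natAbs))
  finite_vertex := inferInstanceAs (Finite Bool)
  bijective_endAt := TwistStrut.bijective_endAt _ _
  planar := by
    rw [TwistStrut.card_face, TwistStrut.card_component]
    change Nat.card (Fin k.natAbs) + Nat.card Bool + _ =
      Nat.card (TwistStrut.Strand k.natAbs) + _
    simp
    ring
  Edge := Fin 3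
  edge := TwistStrut.edge k.natAbs
  edge_surjective := by
    intro e
    fin_cases e
    · exact ⟨.inl (0, false), by simp [TwistStrut.edge]⟩
    · exact ⟨.inl (0, true), by simp [TwistStrut.edge]⟩
    · exact ⟨.inr (), rfl⟩
  edge_eq_iff := TwistStrut.edge_eq_iff _ _

/-- The graph can be oriented: let all strands run upwards and the strut to the right. -/
instance (k : ℤ) : Nonempty (twistStrutGraph k).Orientation := by
  refine ⟨⟨fun _ => true, ?_⟩⟩
  intro c i
  change Fin k.natAbs at c
  have key : ∀ right : Bool, (true = (TwistStrut.crossingEnd k.natAbs right c i).2) ↔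
      ¬ (true = (TwistStrut.crossingEnd k.natAbs right c (i + 2)).2) := by
    intro right
    cases right <;> fin_cases i <;> simp [TwistStrut.crossingEnd]
  exact key _

/-! Put n = |k|. Going up the block, the arcs form one sequence x_0, x_1, …, x_{n+1}, each crossing
giving x_{j+2} = x_j ▷ x_{j+1}. The arcs labelled 2 act as involutions, so ▷ and ▷⁻¹ by them agree
and the orientation matters only for the strut c.

Upper bound. Let σ be the action of x_0 and T the product of the actions of x_1 and x_0. Then x_j
acts as T^j σ, and σ inverts T. Both vertex relations say that c acts as T^n, up to a sign given by
the orientation of the strut. The label m forces T^(nm) = 1, and c ▷ c = c forces T^n to fix c.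
Every element of the quandle acts through ⟨σ, T⟩, so the elements are the T-translates of x_0, x_1
(at most nm each) and of c, σ c (at most n each): at most 2nm + 2n in all
(`DihedralSequence.card_le`).

Lower bound. In the dihedral group D of order 2nm with rotation t and reflection s, the coset spaces
of ⟨s⟩, ⟨ts⟩ and ⟨t^n⟩ have nm, nm and 2n elements. Their union is a quandle in which a coset acts
as the corresponding conjugate of s, ts or t^n; this is `DihedralQuandle`. Cosets stay distinct even
when they act by the same element of D. The diagram is coloured by this model (`isColoring_seq`)
with colours that generate it, so the N-quandle maps onto it. -/

/-! ### Maps out of presented quandles -/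

namespace QuandleTerm

/-- The value of a quandle expression under an assignment of the generators. -/
def eval {S Q : Type} [Quandle Q] (f : S → Q) : QuandleTerm S → Q
  | .gen s => f s
  | .act x y => Rack.act' (y.eval f) (x.eval f)
  | .invAct x y => (Rack.act' (y.eval f))⁻¹ (x.eval f)

/-- The two exponents are kept apart because the label of an edge becomes 2 or `m` only after the
edge of the strand has been computed. -/
theorem eval_iterate_act {S Q : Type} [Quandle Q] (f : S → Q) (x y : QuandleTerm S)
    {l l' : ℕ} (hl : l = l') :
    ((fun z => z.act y)^[l] x).eval f = (Rack.act' (y.eval f) ^ l') (x.eval f) := by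
  subst hl
  induction l with
  | zero => rfl
  | succ l ih => rw [Function.iterate_succ_apply', eval, ih, pow_succ', Equiv.Perm.mul_apply]

theorem Congr.eval_eq {S Q : Type} [Quandle Q] {r : QuandleTerm S → QuandleTerm S → Prop}
    {f : S → Q} (hf : ∀ x y, r x y → x.eval f = y.eval f) {x y : QuandleTerm S}
    (h : Congr r x y) : x.eval f = y.eval f := by
  induction h with
  | of h => exact hf _ _ h
  | refl => rfl
  | symm _ ih => exact ih.symm
  | trans _ _ ih1 ih2 => exact ih1.trans ih2
  | act _ _ ih1 ih2 => simp only [eval, ih1, ih2]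
  | invAct _ _ ih1 ih2 => simp only [eval, ih1, ih2]
  | idem x => exact Quandle.fix
  | act_invAct x y => exact Rack.left_inv _ _
  | invAct_act x y => exact Rack.right_inv _ _
  | distrib x y z => exact Rack.self_distrib

end QuandleTerm

namespace PresentedQuandle

variable {S : Type} {r : QuandleTerm S → QuandleTerm S → Prop}

/-- The element of the presented quandle that an expression denotes. -/
def mk (r : QuandleTerm S → QuandleTerm S → Prop) (x : QuandleTerm S) : PresentedQuandle r :=
  Quot.mk _ x

theorem sound {x y : QuandleTerm S} (h : r x y) : mk r x = mk r y := Quot.sound (.of h)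

theorem mk_act (x y : QuandleTerm S) : mk r (x.act y) = Rack.act' (mk r y) (mk r x) := rfl

theorem mk_invAct (x y : QuandleTerm S) :
    mk r (x.invAct y) = (Rack.act' (mk r y))⁻¹ (mk r x) := rfl

/-- The map to `Q` given by an assignment of the generators that satisfies the relations. -/
def lift {Q : Type} [Quandle Q] (f : S → Q) (hf : ∀ x y, r x y → x.eval f = y.eval f) :
    PresentedQuandle r → Q :=
  Quot.lift (QuandleTerm.eval f) fun _ _ h => h.eval_eq hf

/-- This makes the tautological assignment of the generators satisfy the defining relations, so the
presented quandle can be treated as one more coloured quandle. -/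
theorem mk_eq_eval (x : QuandleTerm S) : mk r x = x.eval fun s => mk r (.gen s) := by
  induction x with
  | gen s => rfl
  | act x y hx hy => rw [mk_act, QuandleTerm.eval, hx, hy]
  | invAct x y hx hy => rw [mk_invAct, QuandleTerm.eval, hx, hy]

theorem lift_act {Q : Type} [Quandle Q] (f : S → Q)
    (hf : ∀ x y, r x y → x.eval f = y.eval f) (a b : PresentedQuandle r) :
    lift f hf (Rack.act' b a) = Rack.act' (lift f hf b) (lift f hf a) := by
  obtain ⟨a⟩ := a
  obtain ⟨b⟩ := b
  rfl

theorem induction {p : PresentedQuandle r → Prop} (gen : ∀ s, p (mk r (.gen s)))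
    (act : ∀ x y, p x → p y → p (Rack.act' y x))
    (invAct : ∀ x y, p x → p y → p ((Rack.act' y)⁻¹ x)) (q : PresentedQuandle r) : p q := by
  obtain ⟨t⟩ := q
  change p (mk r t)
  induction t with
  | gen s => exact gen s
  | act x y hx hy => exact act _ _ hx hy
  | invAct x y hx hy => exact invAct _ _ hx hy

end PresentedQuandle

/-! ### Quandles generated by a dihedral sequence and an element that acts as a rotation -/

namespace DihedralSequence

variable {Q : Type} [Quandle Q] {x : ℕ → Q}

/-- The sequence with given first two terms, each further term being the image of the one two
places before under the action of its predecessor. -/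
def ofPair (p q : Q) : ℕ → Q
  | 0 => p
  | 1 => q
  | j + 2 => Rack.act' (ofPair p q (j + 1)) (ofPair p q j)

theorem act_ofPair_mul_self {p q : Q} (hp : Rack.act' p * Rack.act' p = 1)
    (hq : Rack.act' q * Rack.act' q = 1) :
    ∀ j, Rack.act' (ofPair p q j) * Rack.act' (ofPair p q j) = 1
  | 0 => hp
  | 1 => hq
  | j + 2 => by
    have h : Rack.act' (ofPair p q (j + 2)) = Rack.act' (ofPair p q (j + 1)) *
        Rack.act' (ofPair p q j) * (Rack.act' (ofPair p q (j + 1)))⁻¹ := Rack.ad_conj _ _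
    rw [h, conj_mul, act_ofPair_mul_self hp hq j, mul_one, mul_inv_cancel]

/-- The action of x_{j+2} is that of x_j conjugated by that of x_{j+1}, so multiplying it by the
action of x_{j+1} cancels the last factor: the product of neighbouring actions does not depend on j.
-/
theorem act_mul_act (hx : ∀ j, x (j + 2) = Rack.act' (x (j + 1)) (x j)) (j : ℕ) :
    Rack.act' (x (j + 1)) * Rack.act' (x j) = Rack.act' (x 1) * Rack.act' (x 0) := by
  induction j with
  | zero => rfl
  | succ j ih =>
    have h : Rack.act' (x (j + 2)) =
        Rack.act' (x (j + 1)) * Rack.act' (x j) * (Rack.act' (x (j + 1)))⁻¹ := by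
      rw [hx]; exact Rack.ad_conj _ _
    rw [h, ← ih]
    group

theorem act_eq (hx : ∀ j, x (j + 2) = Rack.act' (x (j + 1)) (x j))
    (h2 : ∀ j, Rack.act' (x j) * Rack.act' (x j) = 1) (j : ℕ) :
    Rack.act' (x j) = (Rack.act' (x 1) * Rack.act' (x 0)) ^ j * Rack.act' (x 0) := by
  induction j with
  | zero => simp
  | succ j ih =>
    rw [pow_succ', mul_assoc, ← ih, ← act_mul_act hx j, mul_assoc, h2, mul_one]

theorem act_mul_act_zero (hx : ∀ j, x (j + 2) = Rack.act' (x (j + 1)) (x j))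
    (h2 : ∀ j, Rack.act' (x j) * Rack.act' (x j) = 1) (n j : ℕ) :
    Rack.act' (x (n + j)) * Rack.act' (x j) = (Rack.act' (x 1) * Rack.act' (x 0)) ^ n := by
  rw [act_eq hx h2 (n + j), pow_add, mul_assoc _ _ (Rack.act' (x 0)), ← act_eq hx h2 j,
    mul_assoc, h2, mul_one]

/-- As x_j fixes itself, acting on it by x_{j+1} is the same as applying the constant product of two
neighbouring actions. -/
theorem apply_two_mul_add (hx : ∀ j, x (j + 2) = Rack.act' (x (j + 1)) (x j)) (i j : ℕ) :
    x (2 * j + i) = ((Rack.act' (x 1) * Rack.act' (x 0)) ^ j) (x i) := by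
  induction j with
  | zero => simp
  | succ j ih =>
    have h : Rack.act' (x (2 * j + i)) (x (2 * j + i)) = x (2 * j + i) := Quandle.fix
    rw [show 2 * (j + 1) + i = 2 * j + i + 2 by ring, hx, ← h, ← Equiv.Perm.mul_apply,
      act_mul_act hx, ih, pow_succ', Equiv.Perm.mul_apply (_ * _)]

theorem zpow_apply_eq_pow_apply {α : Type} {T : Equiv.Perm α} {N : ℕ} (hN : 0 < N) {a : α}
    (h : (T ^ N) a = a) (i : ℤ) : ∃ j : Fin N, (T ^ i) a = (T ^ (j : ℕ)) a := by
  have hN' : (0 : ℤ) < N := by exact_mod_cast hN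
  have h0 := Int.emod_nonneg i hN'.ne'
  have h1 := Int.emod_lt_of_pos i hN'
  refine ⟨⟨(i % N).toNat, by omega⟩, ?_⟩
  have hz : ∀ z : ℤ, ((T ^ N) ^ z) a = a := fun z => by
    have : (T ^ N) ∈ MulAction.stabilizer (Equiv.Perm α) a := h
    exact zpow_mem this z
  have key : T ^ i = T ^ (i % N).toNat * (T ^ N) ^ (i / N) := by
    rw [← zpow_natCast, ← zpow_natCast T N, ← zpow_mul, ← zpow_add, Int.toNat_of_nonneg h0,
      Int.emod_add_mul_ediv]
  rw [key, Equiv.Perm.mul_apply, hz]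

/-- `hind` says that the x_j and `c` generate `Q`. The two alternatives in `hc` are the two
directions of the strut. -/
theorem card_le (hx : ∀ j, x (j + 2) = Rack.act' (x (j + 1)) (x j))
    (h2 : ∀ j, Rack.act' (x j) * Rack.act' (x j) = 1) {n m : ℕ} (hn : 0 < n) (hm : 0 < m) {c : Q}
    (hc : Rack.act' c = (Rack.act' (x 1) * Rack.act' (x 0)) ^ n ∨
      (Rack.act' c)⁻¹ = (Rack.act' (x 1) * Rack.act' (x 0)) ^ n)
    (hcm : Rack.act' c ^ m = 1)
    (hind : ∀ p : Q → Prop, (∀ j, p (x j)) → p c → (∀ a b, p a → p b → p (Rack.act' b a)) →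
      (∀ a b, p a → p b → p ((Rack.act' b)⁻¹ a)) → ∀ q, p q) :
    Finite Q ∧ Nat.card Q ≤ 2 * n * m + 2 * n := by
  have hxT := apply_two_mul_add hx
  have hσT := act_eq hx h2
  set σ := Rack.act' (x 0) with hσ
  set T := Rack.act' (x 1) * σ with hT
  have hσσ : σ * σ = 1 := h2 0
  have hσi : σ⁻¹ = σ := inv_eq_of_mul_eq_one_left hσσ
  have hTi : σ * T * σ⁻¹ = T⁻¹ := by
    have h11 : (Rack.act' (x 1))⁻¹ = Rack.act' (x 1) := inv_eq_of_mul_eq_one_left (h2 1)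
    rw [hT, mul_inv_rev, h11, hσi, mul_assoc, mul_assoc, hσσ, mul_one]
  have hTz : ∀ i : ℤ, σ * T ^ i = T ^ (-i) * σ := by
    intro i
    rw [zpow_neg, ← inv_zpow, ← hTi, conj_zpow]
    group
  have hTnm : T ^ (n * m) = 1 := by
    rw [pow_mul]
    rcases hc with hc | hc
    · rw [← hc, hcm]
    · rw [← hc, inv_pow, hcm, inv_one]
  have hcc : Rack.act' c c = c := Quandle.fix
  have hTc : (T ^ n) c = c := by
    rcases hc with hc | hc
    · rw [← hc, hcc]
    · rw [← hc, Equiv.Perm.inv_eq_iff_eq, hcc]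
  -- T^n σ = σ T^(-n), and T^(-n) fixes c.
  have hTσc : (T ^ n) (σ c) = σ c := by
    have h := hTz (-n)
    rw [neg_neg, zpow_neg, zpow_natCast] at h
    rw [← Equiv.Perm.mul_apply, ← h, Equiv.Perm.mul_apply]
    congr 1
    rw [Equiv.Perm.inv_eq_iff_eq, hTc]
  have hσ0 : σ (x 0) = x 0 := Quandle.fix
  -- T⁻¹ is σ times the action of x_1, and x_1 fixes itself.
  have hσ1 : σ (x 1) = (T ^ (-1 : ℤ)) (x 1) := by
    have h : Rack.act' (x 1) (x 1) = x 1 := Quandle.fix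
    rw [zpow_neg_one, ← hTi]
    change _ = (σ * (Rack.act' (x 1) * σ) * σ⁻¹) (x 1)
    rw [show σ * (Rack.act' (x 1) * σ) * σ⁻¹ = σ * Rack.act' (x 1) by group,
      Equiv.Perm.mul_apply, h]
  -- Representatives x_0, x_1, c, σ c; the set `S` of their T-translates turns out to be all of `Q`.
  let base : Bool ⊕ Bool → Q :=
    Sum.elim (fun b => x b.toNat) (fun b => if b then σ c else c)
  let S : Set Q := {q | ∃ (s : Bool ⊕ Bool) (i : ℤ), q = (T ^ i) (base s)}
  have hST : ∀ i : ℤ, ∀ q ∈ S, (T ^ i) q ∈ S := by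
    rintro i _ ⟨s, j, rfl⟩
    exact ⟨s, i + j, by rw [zpow_add, Equiv.Perm.mul_apply]⟩
  have hSσ : ∀ q ∈ S, σ q ∈ S := by
    rintro _ ⟨s, j, rfl⟩
    rw [← Equiv.Perm.mul_apply, hTz, Equiv.Perm.mul_apply]
    refine hST _ _ ?_
    rcases s with (_ | _) | (_ | _)
    · exact ⟨.inl false, 0, hσ0⟩
    · exact ⟨.inl true, -1, hσ1⟩
    · exact ⟨.inr true, 0, rfl⟩
    · exact ⟨.inr false, 0, by
        change σ (σ c) = c
        rw [← Equiv.Perm.mul_apply, hσσ, Equiv.Perm.one_apply]⟩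
  let H : Subgroup (Equiv.Perm Q) := Subgroup.closure {σ, T}
  have hσH : σ ∈ H := Subgroup.subset_closure (by simp)
  have hTH : T ∈ H := Subgroup.subset_closure (by simp)
  have hSH : ∀ h ∈ H, ∀ q ∈ S, h q ∈ S := by
    intro h hh
    induction hh using Subgroup.closure_induction'' with
    | mem h hh =>
      rcases hh with rfl | rfl
      · exact hSσ
      · simpa using hST 1
    | inv_mem h hh =>
      rcases hh with rfl | rfl
      · rw [hσi]; exact hSσ
      · simpa using hST (-1)
    | one => exact fun q hq => hq
    | mul a b _ _ iha ihb => exact fun q hq => iha _ (ihb _ hq)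
  -- Membership in `S` and acting through `H` are proved together: a product stays in `S` because
  -- its right factor acts through `H`, and it acts through `H` by conjugation.
  have hall : ∀ q, q ∈ S ∧ Rack.act' q ∈ H := by
    refine hind _ ?_ ?_ ?_ ?_
    · intro j
      refine ⟨⟨.inl j.bodd, (j.div2 : ℤ), ?_⟩, ?_⟩
      · rw [zpow_natCast]
        change _ = (T ^ j.div2) (x j.bodd.toNat)
        rw [← hxT]
        congr 1
        have := Nat.bodd_add_div2 j
        omega
      · rw [hσT]
        exact mul_mem (pow_mem hTH _) hσH
    · refine ⟨⟨.inr false, 0, rfl⟩, ?_⟩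
      rcases hc with hc | hc
      · rw [hc]; exact pow_mem hTH _
      · rw [← inv_mem_iff, hc]; exact pow_mem hTH _
    · rintro a b ⟨ha, ha'⟩ ⟨hb, hb'⟩
      refine ⟨hSH _ hb' _ ha, ?_⟩
      have h : Rack.act' (Rack.act' b a) = Rack.act' b * Rack.act' a * (Rack.act' b)⁻¹ :=
        Rack.ad_conj _ _
      rw [h]
      exact mul_mem (mul_mem hb' ha') (inv_mem hb')
    · rintro a b ⟨ha, ha'⟩ ⟨hb, hb'⟩
      refine ⟨hSH _ (inv_mem hb') _ ha, ?_⟩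
      -- The conjugation formula for ▷⁻¹ comes from that for ▷, applied to the element that b sends
      -- to a.
      have h : Rack.act' (Rack.act' b ((Rack.act' b)⁻¹ a)) =
          Rack.act' b * Rack.act' ((Rack.act' b)⁻¹ a) * (Rack.act' b)⁻¹ := Rack.ad_conj _ _
      rw [← Equiv.Perm.mul_apply, mul_inv_cancel, Equiv.Perm.one_apply] at h
      rw [show Rack.act' ((Rack.act' b)⁻¹ a) = (Rack.act' b)⁻¹ * Rack.act' a * Rack.act' b by
        rw [h]; group]
      exact mul_mem (mul_mem (inv_mem hb') ha') hb'
  let g : (Fin (n * m) × Bool) ⊕ (Fin n × Bool) → Q :=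
    Sum.elim (fun p => (T ^ (p.1 : ℕ)) (base (.inl p.2)))
      (fun p => (T ^ (p.1 : ℕ)) (base (.inr p.2)))
  have hg : Function.Surjective g := by
    intro q
    obtain ⟨⟨s, i, rfl⟩, -⟩ := hall q
    rcases s with b | b
    · obtain ⟨j, hj⟩ := zpow_apply_eq_pow_apply (Nat.mul_pos hn hm)
        (show (T ^ (n * m)) (base (.inl b)) = base (.inl b) by rw [hTnm]; rfl) i
      exact ⟨.inl (j, b), hj.symm⟩
    · obtain ⟨j, hj⟩ := zpow_apply_eq_pow_apply hn
        (show (T ^ n) (base (.inr b)) = base (.inr b) by cases b; exacts [hTc, hTσc]) i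
      exact ⟨.inr (j, b), hj.symm⟩
  refine ⟨Finite.of_surjective g hg, (Nat.card_le_card_of_surjective g hg).trans_eq ?_⟩
  simp
  ring

end DihedralSequence

/-! ### A model of the quandle -/

/-- Two orbits of reflections in the dihedral group of order `2 * n * m`, with its rotation `t`, and
the cosets of the subgroup generated by `t ^ n`. -/
inductive DihedralQuandle (n m : ℕ) : Type
  /-- the conjugate by `t ^ j` of the reflection number `0` or `1` -/
  | reflection (j : ZMod (n * m)) (b : Bool)
  /-- the coset of `t ^ i` or of its product with a reflection; it acts as `t ^ n` or `t ^ (-n)` -/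
  | rotation (i : ZMod n) (s : Bool)

namespace DihedralQuandle

variable {n m : ℕ}

/-- Reduction of rotation exponents modulo `n`. -/
def red (n m : ℕ) : ZMod (n * m) →+* ZMod n := ZMod.castHom (dvd_mul_right n m) (ZMod n)

/-- The exponent of the rotation by which the elements `rotation _ s` act. -/
def rot (n m : ℕ) (s : Bool) : ZMod (n * m) := if s then -n else n

theorem red_rot (s : Bool) : red n m (rot n m s) = 0 := by
  cases s <;> simp [rot]

theorem rot_not (s : Bool) : rot n m (!s) = -rot n m s := by
  cases s <;> simp [rot]

/-- `op y x` is `x ▷ y`. -/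
def op : DihedralQuandle n m → DihedralQuandle n m → DihedralQuandle n m
  | reflection j b, reflection k c => reflection (2 * j + b.toNat - c.toNat - k) c
  | reflection j b, rotation i s => rotation (red n m (2 * j + b.toNat) - i) (!s)
  | rotation _ s, reflection k c => reflection (k + rot n m s) c
  | rotation _ _, rotation i s => rotation i s

/-- `invOp y x` is `x ▷⁻¹ y`. -/
def invOp : DihedralQuandle n m → DihedralQuandle n m → DihedralQuandle n m
  | reflection j b, q => op (reflection j b) q
  | rotation i s, q => op (rotation i (!s)) q

instance : Quandle (DihedralQuandle n m) where
  act := op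
  invAct := invOp
  self_distrib := by
    rintro (⟨j, b⟩ | ⟨j, b⟩) (⟨k, c⟩ | ⟨k, c⟩) (⟨l, d⟩ | ⟨l, d⟩) <;>
      simp only [op, rot_not, map_add, map_mul, map_sub, red_rot, Bool.not_not, map_natCast,
        map_ofNat]
    all_goals first | rfl | (congr 1; ring)
  left_inv := by
    rintro (⟨j, b⟩ | ⟨j, b⟩) (⟨l, d⟩ | ⟨l, d⟩) <;> simp only [invOp, op, rot_not, Bool.not_not]
    all_goals first | rfl | (congr 1; ring)
  right_inv := by
    rintro (⟨j, b⟩ | ⟨j, b⟩) (⟨l, d⟩ | ⟨l, d⟩) <;> simp only [invOp, op, rot_not, Bool.not_not]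
    all_goals first | rfl | (congr 1; ring)
  fix := by
    rintro (⟨j, b⟩ | ⟨j, b⟩) <;> simp only [op]
    congr 1; ring

theorem act'_rotation_reflection (i : ZMod n) (s : Bool) (k : ZMod (n * m)) (c : Bool) :
    Rack.act' (rotation i s) (reflection k c) = reflection (k + rot n m s) c := rfl

theorem act'_rotation_rotation (i j : ZMod n) (s t : Bool) :
    Rack.act' (rotation i s : DihedralQuandle n m) (rotation j t) = rotation j t := rfl

/-- The reflection number `j`. -/
def seq (n m j : ℕ) : DihedralQuandle n m := reflection j.div2 j.bodd

theorem cast_bodd_add_div2 {R : Type} [CommRing R] (j : ℕ) :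
    2 * (j.div2 : R) + (j.bodd.toNat : R) = j := by
  conv_rhs => rw [← Nat.bodd_add_div2 j]
  push_cast
  ring

theorem act'_seq_reflection (j : ℕ) (k : ZMod (n * m)) (c : Bool) :
    Rack.act' (seq n m j) (reflection k c) =
      reflection ((j : ZMod (n * m)) - (c.toNat : ZMod (n * m)) - k) c := by
  change reflection (2 * (j.div2 : ZMod (n * m)) + (j.bodd.toNat : ZMod (n * m)) -
    (c.toNat : ZMod (n * m)) - k) c = _
  rw [cast_bodd_add_div2]

theorem act'_seq_rotation (j : ℕ) (i : ZMod n) (s : Bool) :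
    Rack.act' (seq n m j) (rotation i s) = rotation ((j : ZMod n) - i) (!s) := by
  change rotation (red n m (2 * (j.div2 : ZMod (n * m)) + (j.bodd.toNat : ZMod (n * m))) - i) (!s) = _
  rw [cast_bodd_add_div2, map_natCast]

theorem seq_add_two (j : ℕ) : seq n m (j + 2) = Rack.act' (seq n m (j + 1)) (seq n m j) := by
  conv_rhs => rw [seq.eq_1 n m j, act'_seq_reflection]
  have h := cast_bodd_add_div2 (R := ZMod (n * m)) j
  have h1 : (j + 2).div2 = j.div2 + 1 := by
    rw [Nat.div2_val, Nat.div2_val]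
    omega
  have h2 : (j + 2).bodd = j.bodd := by simp
  rw [seq, h1, h2]
  congr 1
  push_cast
  rw [← h]
  ring

theorem act'_seq_mul_self (j : ℕ) :
    Rack.act' (seq n m j) * Rack.act' (seq n m j) = 1 := by
  ext (⟨k, c⟩ | ⟨i, s⟩)
  · rw [Equiv.Perm.mul_apply, act'_seq_reflection, act'_seq_reflection, sub_sub_cancel]
    rfl
  · rw [Equiv.Perm.mul_apply, act'_seq_rotation, act'_seq_rotation, sub_sub_cancel, Bool.not_not]
    rfl

/-- The product of two reflections depends only on the difference of their numbers. The cases j = 0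
and j = 1 give the relations at the two vertices. -/
theorem act'_seq_mul_act'_seq (n m j : ℕ) :
    Rack.act' (seq n m (n + j)) * Rack.act' (seq n m j) = Rack.act' (rotation 0 false) := by
  ext (⟨k, c⟩ | ⟨i, s⟩)
  · rw [Equiv.Perm.mul_apply, act'_seq_reflection, act'_seq_reflection, act'_rotation_reflection]
    congr 1
    simp only [rot, Nat.cast_add, Bool.false_eq_true, if_false]
    ring
  · rw [Equiv.Perm.mul_apply, act'_seq_rotation, act'_seq_rotation, act'_rotation_rotation]
    simp

theorem act'_rotation_inv (i : ZMod n) (s : Bool) :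
    (Rack.act' (rotation i s : DihedralQuandle n m))⁻¹ = Rack.act' (rotation i (!s)) := by
  ext (⟨k, c⟩ | ⟨j, t⟩) <;> rfl

theorem act'_rotation_pow (i : ZMod n) (s : Bool) :
    Rack.act' (rotation i s : DihedralQuandle n m) ^ m = 1 := by
  have h : ∀ (l : ℕ) (k : ZMod (n * m)) (c : Bool),
      (Rack.act' (rotation i s) ^ l) (reflection k c) = reflection (k + (l : ZMod (n * m)) * rot n m s) c := by
    intro l k c
    induction l with
    | zero => simp
    | succ l ih =>
      rw [pow_succ', Equiv.Perm.mul_apply, ih, act'_rotation_reflection]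
      congr 1
      push_cast
      ring
  have h' : ∀ (l : ℕ) (j : ZMod n) (t : Bool),
      (Rack.act' (rotation i s : DihedralQuandle n m) ^ l) (rotation j t) = rotation j t := by
    intro l j t
    induction l with
    | zero => rfl
    | succ l ih => rw [pow_succ', Equiv.Perm.mul_apply, ih, act'_rotation_rotation]
  -- The m-th power shifts reflection exponents by ± n m, which vanishes modulo n m.
  have h0 : (m : ZMod (n * m)) * rot n m s = 0 := by
    have : (n : ZMod (n * m)) * m = 0 := by
      rw [← Nat.cast_mul, ZMod.natCast_self]
    cases s <;> simp [rot, mul_comm, this]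
  ext (⟨k, c⟩ | ⟨j, t⟩)
  · rw [h, h0, add_zero]; rfl
  · rw [h']; rfl

/-- Acting by reflections 0 and 1 in turn raises every exponent by 1, and reflection 0 exchanges the
two kinds of cosets. Exponents are residues, so natural powers reach them all and closure under ▷⁻¹
is not needed. -/
theorem induction [NeZero n] [NeZero m] {p : DihedralQuandle n m → Prop} (h0 : p (seq n m 0))
    (h1 : p (seq n m 1)) {s : Bool} (hs : p (rotation 0 s))
    (hact : ∀ x y, p x → p y → p (Rack.act' y x)) (q : DihedralQuandle n m) : p q := by
  have hrefl : ∀ (b : Bool) (j : ℕ), p (reflection j b) := by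
    intro b j
    induction j with
    | zero => cases b; exacts [by simpa [seq] using h0, by simpa [seq] using h1]
    | succ j ih =>
      have h := hact _ _ (hact _ _ ih h0) h1
      rw [act'_seq_reflection, act'_seq_reflection] at h
      convert h using 2
      push_cast
      ring
  have hrot0 : ∀ b, p (rotation 0 b) := by
    have h := hact _ _ hs h0
    rw [act'_seq_rotation, Nat.cast_zero, sub_zero] at h
    intro b
    by_cases hb : b = s
    · rwa [hb]
    · rwa [Bool.eq_not_of_ne hb]
  have hrot : ∀ (b : Bool) (j : ℕ), p (rotation j b) := by
    intro b j
    induction j with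
    | zero => simpa using hrot0 b
    | succ j ih =>
      have h := hact _ _ (hact _ _ ih h0) h1
      rw [act'_seq_rotation, act'_seq_rotation, Bool.not_not] at h
      convert h using 2
      push_cast
      ring
  rcases q with ⟨j, b⟩ | ⟨j, b⟩
  · have h := hrefl b j.val
    rwa [ZMod.natCast_zmod_val] at h
  · have h := hrot b j.val
    rwa [ZMod.natCast_zmod_val] at h

/-- The elements of the model as a sum type. -/
def equivSum (n m : ℕ) : DihedralQuandle n m ≃ (ZMod (n * m) × Bool) ⊕ (ZMod n × Bool) where
  toFun
    | reflection j b => .inl (j, b)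
    | rotation i s => .inr (i, s)
  invFun := Sum.elim (fun p => reflection p.1 p.2) (fun p => rotation p.1 p.2)
  left_inv := by rintro (_ | _) <;> rfl
  right_inv := by rintro (_ | _) <;> rfl

theorem card_eq [NeZero n] [NeZero m] :
    Nat.card (DihedralQuandle n m) = 2 * n * m + 2 * n := by
  rw [Nat.card_congr (equivSum n m), Nat.card_sum, Nat.card_prod, Nat.card_prod, Nat.card_zmod,
    Nat.card_zmod, Nat.card_eq_fintype_card (α := Bool), Fintype.card_bool]
  ring

end DihedralQuandle

/-! ### The `N`-quandle of `G(k, m)` -/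

theorem natAbs_bodd_of_odd {k : ℤ} (hk : Odd k) : k.natAbs.bodd = true := by
  have h := Int.natAbs_odd.2 hk
  rw [Nat.odd_iff, Nat.mod_two_of_bodd] at h
  revert h
  cases k.natAbs.bodd <;> simp

theorem natAbs_bodd_of_even {k : ℤ} (hk : Even k) : k.natAbs.bodd = false := by
  have h := Int.natAbs_even.2 hk
  rw [Nat.even_iff, Nat.mod_two_of_bodd] at h
  revert h
  cases k.natAbs.bodd <;> simp

/-! ### The underlying abstract graph -/

namespace TwistStrut

/-- The edges that end at a vertex, as a function of the parity of the number of crossings. -/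
def edgeAt (odd : Bool) : Bool → Fin 3 → Fin 3
  | false => ![0, if odd then 1 else 0, 2]
  | true => ![1, 2, if odd then 0 else 1]

theorem edge_vertexEnd (n : ℕ) (v : Bool) (i : Fin 3) :
    edge n (vertexEnd n v i).1 = edgeAt n.bodd v i := by
  cases v <;> fin_cases i <;> cases h : n.bodd <;> simp [edge, vertexEnd, edgeAt, h]

/-- The right-hand side depends on `k` only through the parity of the number of crossings, so the
graph type can be settled by `decide`. -/
theorem edgeEnds_eq (k : ℤ) (v : Bool) (e : Fin 3) :
    (twistStrutGraph k).edgeEnds v e =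
      (Finset.univ.filter fun i => edgeAt k.natAbs.bodd v i = e).card := by
  rw [← Fintype.card_subtype, ← Nat.card_eq_fintype_card]
  refine Nat.card_congr (Equiv.subtypeEquivRight fun i => ?_)
  exact Eq.congr_left (edge_vertexEnd k.natAbs v i)

end TwistStrut

theorem twistStrutGraph_isTheta {k : ℤ} (hk : Odd k) : (twistStrutGraph k).IsTheta := by
  refine ⟨false, true, Bool.false_ne_true, fun w => by cases (w : Bool); exacts [.inl rfl, .inr rfl],
    (0 : Fin 3), (1 : Fin 3), (2 : Fin 3), ?_⟩
  change (0 : Fin 3) ≠ 1 ∧ (0 : Fin 3) ≠ 2 ∧ (1 : Fin 3) ≠ 2 ∧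
    (∀ e : Fin 3, e = 0 ∨ e = 1 ∨ e = 2) ∧ ∀ e : Fin 3, _
  simp only [TwistStrut.edgeEnds_eq, natAbs_bodd_of_odd hk]
  decide

theorem twistStrutGraph_isHandcuff {k : ℤ} (hk : Even k) : (twistStrutGraph k).IsHandcuff := by
  refine ⟨false, true, Bool.false_ne_true, fun w => by cases (w : Bool); exacts [.inl rfl, .inr rfl],
    (0 : Fin 3), (1 : Fin 3), (2 : Fin 3), ?_⟩
  change (0 : Fin 3) ≠ 1 ∧ (0 : Fin 3) ≠ 2 ∧ (1 : Fin 3) ≠ 2 ∧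
    (∀ e : Fin 3, e = 0 ∨ e = 1 ∨ e = 2) ∧ _
  simp only [TwistStrut.edgeEnds_eq, natAbs_bodd_of_even hk]
  decide

/-! ### Colourings of the diagram and the count -/

namespace TwistStrut

open SpatialGraphDiagram QuandleTerm

/-- The position, in the sequence of arcs met while going up the block, of the arc of the strand
that starts after `i` crossings on the side `s`. -/
def index (right : Bool) (i : ℕ) (s : Bool) : ℕ := i + (xor s right).toNat

/-- The action of `c` or its inverse. -/
def signedAct {Q : Type} [Quandle Q] (b : Bool) (c : Q) : Equiv.Perm Q :=
  if b then Rack.act' c else (Rack.act' c)⁻¹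

theorem signedAct_not {Q : Type} [Quandle Q] (b : Bool) (c : Q) :
    signedAct (!b) c = (signedAct b c)⁻¹ := by
  cases b <;> simp [signedAct]

theorem signedAct_of_mul_self {Q : Type} [Quandle Q] (b : Bool) {c : Q}
    (hc : Rack.act' c * Rack.act' c = 1) : signedAct b c = Rack.act' c := by
  cases b
  · exact inv_eq_of_mul_eq_one_left hc
  · rfl

variable {k : ℤ} {Q : Type} [Quandle Q]

theorem eval_foldl {D : SpatialGraphDiagram} (o : D.Orientation) (f : D.Strand → Q)
    (l : List (D.Strand × Bool)) (x : QuandleTerm D.Strand) :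
    (l.foldl (fun z e => if o.Incoming e then z.act (gen e.1) else z.invAct (gen e.1)) x).eval f =
      l.foldl (fun q e => signedAct (o.head e.1 == e.2) (f e.1) q) (x.eval f) := by
  induction l generalizing x with
  | nil => rfl
  | cons e l ih =>
    rw [List.foldl_cons, List.foldl_cons, ih]
    congr 1
    by_cases h : o.Incoming e
    · rw [if_pos h, beq_iff_eq.2 h]
      rfl
    · rw [if_neg h, beq_eq_false_iff_ne.2 h]
      rfl

/-- Only the strut keeps a sign, the other arcs being involutive. It starts at the left vertex and
ends at the right one, hence the inverse on the left only. -/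
theorem eval_vertex (o : (twistStrutGraph k).Orientation) {f : Strand k.natAbs → Q}
    (hf : ∀ p, Rack.act' (f (.inl p)) * Rack.act' (f (.inl p)) = 1) (v : Bool)
    (x : QuandleTerm (twistStrutGraph k).Strand) :
    ((List.ofFn ((twistStrutGraph k).vertexEnd v)).foldl
      (fun z e => if o.Incoming e then z.act (gen e.1) else z.invAct (gen e.1)) x).eval f =
    (if v then
      Rack.act' (f (.inl (Fin.last _, v))) * signedAct (o.head (.inr ())) (f (.inr ())) *
        Rack.act' (f (.inl (0, v)))
    else
      (signedAct (o.head (.inr ())) (f (.inr ())))⁻¹ * Rack.act' (f (.inl (Fin.last _, v))) *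
        Rack.act' (f (.inl (0, v)))) (x.eval f) := by
  refine (eval_foldl o f _ x).trans ?_
  cases v
  · change signedAct (o.head (.inr ()) == false) (f (.inr ()))
      (signedAct (_ == true) (f (.inl (Fin.last _, false)))
        (signedAct (_ == false) (f (.inl (0, false))) (x.eval f))) = _
    rw [signedAct_of_mul_self _ (hf _), signedAct_of_mul_self _ (hf _), beq_false, signedAct_not]
    rfl
  · change signedAct (_ == true) (f (.inl (Fin.last _, true)))
      (signedAct (o.head (.inr ()) == true) (f (.inr ()))
        (signedAct (_ == false) (f (.inl (0, true))) (x.eval f))) = _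
    rw [signedAct_of_mul_self _ (hf _), signedAct_of_mul_self _ (hf _), beq_true]
    rfl

/-- Assignments of elements of a quandle to the strands that satisfy the relations of the
`N`-quandle, stated uniformly in the orientation and in the handedness. -/
structure IsColoring (o : (twistStrutGraph k).Orientation) (m : ℕ)
    (f : Strand k.natAbs → Q) : Prop where
  mul_self : ∀ p, Rack.act' (f (.inl p)) * Rack.act' (f (.inl p)) = 1
  pow_eq_one : Rack.act' (f (.inr ())) ^ m = 1
  over_eq : ∀ c : Fin k.natAbs,
    f (.inl (c.succ, decide (0 < k))) = f (.inl (c.castSucc, !decide (0 < k)))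
  under_eq : ∀ c : Fin k.natAbs, f (.inl (c.succ, !decide (0 < k))) =
    Rack.act' (f (.inl (c.castSucc, !decide (0 < k)))) (f (.inl (c.castSucc, decide (0 < k))))
  vertex : ∀ s, signedAct (o.head (.inr ())) (f (.inr ())) =
    Rack.act' (f (.inl (Fin.last _, s))) * Rack.act' (f (.inl (0, s)))

theorem label_inl (m : ℕ) (p : Fin (k.natAbs + 1) × Bool) :
    (![2, 2, m] : Fin 3 → ℕ) ((twistStrutGraph k).edge (.inl p)) = 2 := by
  change (![2, 2, m] : Fin 3 → ℕ) (if _ then 0 else 1) = 2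
  split_ifs <;> rfl

theorem incoming_iff (o : (twistStrutGraph k).Orientation) (c : Fin k.natAbs) :
    o.Incoming ((twistStrutGraph k).crossingEnd c 1) ↔
      ¬ o.Incoming ((twistStrutGraph k).crossingEnd c 3) :=
  o.coherent c 1

theorem IsColoring.eval_eq {o : (twistStrutGraph k).Orientation} {m : ℕ}
    {f : Strand k.natAbs → Q} (hf : IsColoring o m f) {x y : QuandleTerm (twistStrutGraph k).Strand}
    (h : NRel o ![2, 2, m] x y) : x.eval f = y.eval f := by
  have hsq : ∀ p q, Rack.act' (f (.inl p)) (Rack.act' (f (.inl p)) q) = q := fun p q => by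
    rw [← Equiv.Perm.mul_apply, hf.mul_self]; rfl
  have hover := hf.over_eq
  have hunder := hf.under_eq
  cases h with
  | wirtinger h =>
    rcases h with c | ⟨c, -⟩ | ⟨c, -⟩ | ⟨v, -⟩
    · change f (crossingEnd _ (decide (0 < k)) c 1).1 = f (crossingEnd _ (decide (0 < k)) c 3).1
      cases hr : decide (0 < k) <;> rw [hr] at hover
      · exact (hover c).symm
      · exact hover c
    · change f (crossingEnd _ (decide (0 < k)) c 0).1 =
        Rack.act' (f (crossingEnd _ (decide (0 < k)) c 1).1)
          (f (crossingEnd _ (decide (0 < k)) c 2).1)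
      cases hr : decide (0 < k) <;> rw [hr] at hover hunder
      -- The over-arc runs the other way here, so the under-arc relation is solved for the lower
      -- arc, using that the over-arc is involutive.
      · exact ((congrArg _ (hunder c)).trans (hsq _ _)).symm
      · change f (.inl (c.castSucc, true)) = Rack.act' (f (.inl (c.succ, true))) _
        rw [hover c]
        exact ((congrArg _ (hunder c)).trans (hsq _ _)).symm
    · change f (crossingEnd _ (decide (0 < k)) c 2).1 =
        Rack.act' (f (crossingEnd _ (decide (0 < k)) c 1).1)
          (f (crossingEnd _ (decide (0 < k)) c 0).1)
      cases hr : decide (0 < k) <;> rw [hr] at hover hunder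
      · exact hunder c
      · change _ = Rack.act' (f (.inl (c.succ, true))) _
        rw [hover c]
        exact hunder c
    · refine (eval_vertex o hf.mul_self v y).trans ?_
      rw [hf.vertex v]
      cases v
      · rw [if_neg Bool.false_ne_true, mul_assoc, inv_mul_cancel]
        rfl
      · rw [if_pos rfl, ← mul_assoc, hf.mul_self, one_mul, hf.mul_self]
        rfl
  | power x s =>
    rcases s with p | u
    · refine (eval_iterate_act f y (gen (.inl p)) (label_inl m p)).trans ?_
      rw [pow_two]
      exact hsq _ _
    · refine (eval_iterate_act f y (gen (.inr ())) (rfl : _ = m)).trans ?_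
      change (Rack.act' (f (.inr ())) ^ m) _ = _
      rw [hf.pow_eq_one]
      rfl

/-- The power and vertex relations are imposed on every expression x. Since the values of
expressions exhaust `Q`, they become identities between permutations of `Q`. -/
theorem isColoring_of_eval_eq {o : (twistStrutGraph k).Orientation} {m : ℕ}
    {f : Strand k.natAbs → Q} (hsurj : ∀ q, ∃ x : QuandleTerm (Strand k.natAbs), x.eval f = q)
    (h : ∀ x y : QuandleTerm (twistStrutGraph k).Strand,
      NRel o ![2, 2, m] x y → x.eval f = y.eval f) :
    IsColoring o m f := by
  have hms : ∀ p, Rack.act' (f (.inl p)) * Rack.act' (f (.inl p)) = 1 := by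
    intro p
    ext q
    obtain ⟨x, rfl⟩ := hsurj q
    have := (eval_iterate_act f x (gen (.inl p)) (label_inl m p)).symm.trans
      (h _ _ (.power (D := twistStrutGraph k) x (Sum.inl p : Strand k.natAbs)))
    rwa [pow_two] at this
  have hsq : ∀ p q, Rack.act' (f (.inl p)) (Rack.act' (f (.inl p)) q) = q := fun p q => by
    rw [← Equiv.Perm.mul_apply, hms]; rfl
  have hover : ∀ c : Fin k.natAbs,
      f (.inl (c.succ, decide (0 < k))) = f (.inl (c.castSucc, !decide (0 < k))) := by
    intro c
    have h1 : f (crossingEnd _ (decide (0 < k)) c 1).1 = f (crossingEnd _ (decide (0 < k)) c 3).1 :=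
      h _ _ (.wirtinger (.over (D := twistStrutGraph k) c))
    revert h1
    cases decide (0 < k)
    · exact Eq.symm
    · exact id
  refine ⟨hms, ?_, hover, ?_, ?_⟩
  · ext q
    obtain ⟨x, rfl⟩ := hsurj q
    exact (eval_iterate_act f x (gen (.inr ())) (rfl : _ = m)).symm.trans
      (h _ _ (.power (D := twistStrutGraph k) x (Sum.inr () : Strand k.natAbs)))
  · intro c
    have h1 : f (crossingEnd _ (decide (0 < k)) c 2).1 =
          Rack.act' (f (crossingEnd _ (decide (0 < k)) c 1).1)
            (f (crossingEnd _ (decide (0 < k)) c 0).1) ∨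
        f (crossingEnd _ (decide (0 < k)) c 0).1 =
          Rack.act' (f (crossingEnd _ (decide (0 < k)) c 1).1)
            (f (crossingEnd _ (decide (0 < k)) c 2).1) := by
      -- Coherence makes exactly one of the two crossing relations available; `h2` shows that both
      -- have the same content for an involutive over-arc.
      by_cases hc : o.Incoming ((twistStrutGraph k).crossingEnd c 3)
      · exact .inr (h _ _ (.wirtinger (.crossing_from_three (D := twistStrutGraph k) c hc)))
      · exact .inl (h _ _ (.wirtinger (.crossing_from_one (D := twistStrutGraph k) c ((incoming_iff o c).2 hc))))
    have h2 : f (crossingEnd _ (decide (0 < k)) c 2).1 =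
        Rack.act' (f (crossingEnd _ (decide (0 < k)) c 1).1)
          (f (crossingEnd _ (decide (0 < k)) c 0).1) := by
      rcases h1 with h1 | h1
      · exact h1
      · rw [h1]
        revert hsq
        cases decide (0 < k) <;> intro hsq <;> exact (hsq _ _).symm
    have hover' := hover c
    revert h2 hover'
    cases decide (0 < k) <;> intro h2 hover'
    · exact h2
    · change _ = Rack.act' (f (.inl (c.succ, true))) _ at h2
      rw [hover'] at h2
      exact h2
  · intro v
    have h1 : ∀ q, _ = (1 : Equiv.Perm Q) q := fun q => by
      obtain ⟨x, rfl⟩ := hsurj q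
      exact (eval_vertex o hms v x).symm.trans (h _ _ (.wirtinger (.vertex (D := twistStrutGraph k) v x)))
    have h2 := Equiv.Perm.ext h1
    cases v
    · rw [if_neg Bool.false_ne_true, mul_assoc] at h2
      exact inv_mul_eq_one.1 h2
    · rw [if_pos rfl, mul_eq_one_iff_eq_inv, ← eq_inv_mul_iff_mul_eq] at h2
      rw [h2, inv_eq_of_mul_eq_one_left (hms _), inv_eq_of_mul_eq_one_left (hms _)]

/-- The kind of coset given to the strut follows its direction, so that its signed action is always
t^n. -/
theorem isColoring_seq (o : (twistStrutGraph k).Orientation) (m : ℕ) :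
    IsColoring o m (Sum.elim
      (fun p => DihedralQuandle.seq k.natAbs m (index (decide (0 < k)) p.1 p.2))
      (fun _ => .rotation 0 (!o.head (.inr ())))) where
  mul_self _ := DihedralQuandle.act'_seq_mul_self _
  pow_eq_one := DihedralQuandle.act'_rotation_pow _ _
  over_eq c := by simp [index]
  under_eq c := by
    simp only [Sum.elim_inl, index, Fin.val_succ, Fin.val_castSucc, Bool.not_bne_self, bne_self_eq_false,
      Bool.toNat_true, Bool.toNat_false, add_zero]
    exact DihedralQuandle.seq_add_two _
  vertex s := by
    have h := DihedralQuandle.act'_seq_mul_act'_seq k.natAbs m (xor s (decide (0 < k))).toNat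
    simp only [Sum.elim_inl, Sum.elim_inr, index, Fin.val_last, Fin.val_zero, zero_add]
    rw [h]
    cases o.head (.inr ())
    · exact DihedralQuandle.act'_rotation_inv _ _
    · rfl

/-- Between consecutive crossings i - 1 and i the two strands carry terms i and i + 1. The crossing
keeps term i + 1 as its over-arc and replaces term i by term i + 2. -/
theorem IsColoring.eq_ofPair {o : (twistStrutGraph k).Orientation} {m : ℕ}
    {f : Strand k.natAbs → Q} (hf : IsColoring o m f) (i : Fin (k.natAbs + 1)) (s : Bool) :
    f (.inl (i, s)) = DihedralSequence.ofPair (f (.inl (0, decide (0 < k))))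
      (f (.inl (0, !decide (0 < k)))) (index (decide (0 < k)) i s) := by
  have hs : ∀ s, s = decide (0 < k) ∨ s = !decide (0 < k) := fun s => by
    cases s <;> cases decide (0 < k) <;> simp
  induction i using Fin.induction generalizing s with
  | zero => rcases hs s with rfl | rfl <;> simp [index, DihedralSequence.ofPair]
  | succ c ih =>
    rcases hs s with rfl | rfl
    · rw [hf.over_eq, ih]
      simp [index]
    · rw [hf.under_eq, ih, ih]
      simp [index, DihedralSequence.ofPair]

theorem card_fundamentalNQuandle (hk : k ≠ 0) {m : ℕ} (hm : 0 < m)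
    (o : (twistStrutGraph k).Orientation) :
    Nat.card (FundamentalNQuandle o ![2, 2, m]) = 2 * k.natAbs * m + 2 * k.natAbs := by
  have hn : 0 < k.natAbs := Int.natAbs_pos.2 hk
  have : NeZero k.natAbs := ⟨hn.ne'⟩
  have : NeZero m := ⟨hm.ne'⟩
  let r : QuandleTerm (Strand k.natAbs) → QuandleTerm (Strand k.natAbs) → Prop :=
    NRel o ![2, 2, m]
  change Nat.card (PresentedQuandle r) = _
  let f : Strand k.natAbs → PresentedQuandle r := fun s => .mk r (.gen s)
  have hf : IsColoring o m f := by
    refine isColoring_of_eval_eq ?_ ?_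
    · rintro ⟨x⟩
      exact ⟨x, (PresentedQuandle.mk_eq_eval x).symm⟩
    · intro x y h
      exact (PresentedQuandle.mk_eq_eval (r := r) x).symm.trans
        ((PresentedQuandle.sound h).trans (PresentedQuandle.mk_eq_eval y))
  let x := DihedralSequence.ofPair (f (.inl (0, decide (0 < k)))) (f (.inl (0, !decide (0 < k))))
  have hx2 : ∀ j, Rack.act' (x j) * Rack.act' (x j) = 1 :=
    DihedralSequence.act_ofPair_mul_self (hf.mul_self _) (hf.mul_self _)
  have hx : ∀ j, x (j + 2) = Rack.act' (x (j + 1)) (x j) := fun _ => rfl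
  have hc : signedAct (o.head (.inr ())) (f (.inr ())) =
      (Rack.act' (x 1) * Rack.act' (x 0)) ^ k.natAbs := by
    -- On this side the indices at the bottom and the top of the block are 0 and n, so the vertex
    -- relation reads off T^n.
    rw [hf.vertex (decide (0 < k)), hf.eq_ofPair, hf.eq_ofPair,
      ← DihedralSequence.act_mul_act_zero hx hx2 k.natAbs 0]
    simp [index, x, DihedralSequence.ofPair]
  obtain ⟨hfin, hle⟩ := DihedralSequence.card_le (c := f (.inr ())) hx hx2 hn hm
    (by
      revert hc
      cases o.head (.inr ())
      · exact .inr
      · exact .inl)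
    hf.pow_eq_one
    (by
      intro p hp hpc hact hinv q
      refine PresentedQuandle.induction ?_ hact hinv q
      rintro (⟨i, s⟩ | u)
      · change p (f (.inl (i, s)))
        rw [hf.eq_ofPair]
        exact hp _
      · exact hpc)
  have hcol := isColoring_seq o m
  let F := PresentedQuandle.lift _ fun x y (h : r x y) => hcol.eval_eq h
  have hF : Function.Surjective F := by
    -- The image of `F` is closed under ▷ and contains the colours of the two bottom arcs and of the
    -- strut, which generate the model.
    refine DihedralQuandle.induction (s := !o.head (.inr ())) ?_ ?_ ?_ ?_
    · refine ⟨f (.inl (0, decide (0 < k))), ?_⟩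
      change DihedralQuandle.seq _ _ (index _ _ _) = _
      simp [index]
    · refine ⟨f (.inl (0, !decide (0 < k))), ?_⟩
      change DihedralQuandle.seq _ _ (index _ _ _) = _
      simp [index]
    · exact ⟨f (.inr ()), rfl⟩
    · rintro _ _ ⟨a, rfl⟩ ⟨b, rfl⟩
      exact ⟨Rack.act' b a, PresentedQuandle.lift_act _ _ _ _⟩
  refine le_antisymm hle ?_
  rw [← DihedralQuandle.card_eq]
  -- The finiteness `hfin` is needed here, as `Nat.card` of an infinite type is 0.
  exact Nat.card_le_card_of_surjective F hF

end TwistStrut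

theorem corollary5p2 (k : ℤ) (hk : k ≠ 0) (m : ℕ) (hm : 0 < m) :
    (Odd k → (twistStrutGraph k).IsTheta) ∧
    (Even k → (twistStrutGraph k).IsHandcuff) ∧
    ∀ o : (twistStrutGraph k).Orientation,
      Nat.card (SpatialGraphDiagram.FundamentalNQuandle o ![2, 2, m]) =
        2 * k.natAbs * m + 2 * k.natAbs :=
  ⟨twistStrutGraph_isTheta, twistStrutGraph_isHandcuff,
    TwistStrut.card_fundamentalNQuandle hk hm⟩
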